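/- Let $\Gamma$ be a $\mathbb{Z}^d$-periodic graph: a graph without loops or multiple edges, with vertex set $\mathcal V(\Gamma)$ and (undirected) edge set $\mathcal E(\Gamma)$, together with a free action $u\mapsto u+a$ ($a\in\mathbb{Z}^d$) of $\mathbb{Z}^d$ on its vertices that maps edges to edges and for which there are only finitely many orbits of vertices and of edges. A (vertex) fundamental domain is a finite set $W\subset\mathcal V(\Gamma)$ with $\bigcup_{a\in\mathbb{Z}^d}(W+a)=\mathcal V(\Gamma)$ and $|W|=|\mathcal V(\Gamma)/\mathbb{Z}^d|$. A set $U\subseteq W$ is a component of $W$ if there is no edge $(u,v+a)\in\mathcal E(\Gamma)$ with $u\in U$, $v\in W\smallsetminus U$ and $a\in\mathbb{Z}^d$; it has support $0$ if $\{a\in\mathbb{Z}^d : (u,v+a)\in\mathcal E(\Gamma)\text{ for some }u,v\in U\}$ is $\emptyset$ or $\{0\}$. A labeling of $\Gamma$ is a pair $(V,E)$ of functions $V:\mathcal V(\Gamma)\to\mathbb{C}$ and $E:\mathcal E(\Gamma)\to\mathbb{C}$ that are invariant under $\mathbb{Z}^d$, with $E((u,v))=E((v,u))$. The space of labelings is identified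 with a finite-dimensional complex affine space, with one coordinate for each vertex orbit and one for each edge orbit. For a labeling $(V,E)$ and a fundamental domain $W_0$, let $L(z)$ be the $W_0\times W_0$ matrix of Laurent polynomials in $z=(z_1,\dots,z_d)$ given by $$L(z)_{u,v}=\delta_{u,v}V(u)+\sum_{a\in\mathbb{Z}^d:\,(u,v+a)\in\mathcal E(\Gamma)}E((u,v+a))\,z^a ,$$ and let $D(z,\lambda)=\det(L(z)-\lambda I)$ be the dispersion polynomial. It has a linear factor in $\lambda$ (a flat band) if $\lambda-\lambda_0$ divides $D(z,\lambda)$ in $\mathbb{C}[z_1^{\pm1},\dots,z_d^{\pm1},\lambda]$ for some constant $\lambda_0\in\mathbb{C}$. Theorem. There is a proper algebraic subset $S$ of the space of labelings such that, for every labeling $(V,E)\notin S$ and every fundamental domain $W_0$ used to form $D(z,\lambda)$, the dispersion polynomial $D(z,\lambda)$ has a linear factor in $\lambda$ if and only if $\Gamma$ has a fundamental domain $W$ with a nonempty component $U\subseteq W$ of support $0$. -/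

import Mathlib

namespace PeriodicGraph

variable {V : Type*}

/-- The set of vertex orbits `𝒱(Γ) / ℤ^d`. -/
abbrev VertexOrbit (d : ℕ) (V : Type*) [AddAction (Fin d → ℤ) V] : Type _ :=
  AddAction.orbitRel.Quotient (Fin d → ℤ) V

/-- Two (unoriented) edges of `Γ` are equivalent when they are translates of each other. -/
def edgeSetoid (d : ℕ) [AddAction (Fin d → ℤ) V] (Γ : SimpleGraph V) : Setoid Γ.edgeSet where
  r e e' := ∃ a : Fin d → ℤ, e'.1 = Sym2.map (fun v => a +ᵥ v) e.1
  iseqv :=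
    { refl := fun e => ⟨0, by simp⟩
      symm := by
        rintro e e' ⟨a, h⟩
        refine ⟨-a, ?_⟩
        rw [h, Sym2.map_map]
        simp
      trans := by
        rintro e e' e'' ⟨a, h⟩ ⟨b, h'⟩
        refine ⟨b + a, ?_⟩
        rw [h', h, Sym2.map_map]
        simp [add_vadd] }

/-- The set of edge orbits `ℰ(Γ) / ℤ^d`. -/
abbrev EdgeOrbit (d : ℕ) [AddAction (Fin d → ℤ) V] (Γ : SimpleGraph V) : Type _ :=
  Quotient (edgeSetoid d Γ)

/-- The graph `Γ` is `ℤ^d`-periodic: `ℤ^d` acts freely on the vertices, the action preserves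
edges, and the quotient graph is finite (finitely many vertex orbits and edge orbits). -/
structure IsPeriodic (d : ℕ) [AddAction (Fin d → ℤ) V] (Γ : SimpleGraph V) : Prop where
  free : ∀ (a : Fin d → ℤ) (v : V), a +ᵥ v = v → a = 0
  adj_vadd : ∀ (a : Fin d → ℤ) (u v : V), Γ.Adj u v → Γ.Adj (a +ᵥ u) (a +ᵥ v)
  finite_vertexOrbit : Finite (VertexOrbit d V)
  finite_edgeOrbit : Finite (EdgeOrbit d Γ)

/-- A (vertex) fundamental domain: a finite set of vertices whose translates cover all vertices
and whose cardinality is the number of vertex orbits. -/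
def IsFundamentalDomain (d : ℕ) [AddAction (Fin d → ℤ) V] (W : Finset V) : Prop :=
  (∀ v : V, ∃ w ∈ W, ∃ a : Fin d → ℤ, v = a +ᵥ w) ∧ W.card = Nat.card (VertexOrbit d V)

/-- The support `𝒜(U)`: all `a ∈ ℤ^d` such that some edge joins `U` to `U + a`. -/
def support (d : ℕ) [AddAction (Fin d → ℤ) V] (Γ : SimpleGraph V) (U : Finset V) :
    Set (Fin d → ℤ) :=
  {a | ∃ u ∈ U, ∃ v ∈ U, Γ.Adj u (a +ᵥ v)}

/-- `U` has support `0`. -/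
def HasSupportZero (d : ℕ) [AddAction (Fin d → ℤ) V] (Γ : SimpleGraph V) (U : Finset V) : Prop :=
  support d Γ U = ∅ ∨ support d Γ U = {0}

/-- `U ⊆ W` is a component of `W`: no edge of `Γ` joins an orbit of a vertex in `U` to an orbit
of a vertex in `W \ U`. -/
def IsComponent (d : ℕ) [AddAction (Fin d → ℤ) V] (Γ : SimpleGraph V) (W U : Finset V) : Prop :=
  U ⊆ W ∧ ∀ u ∈ U, ∀ v ∈ W, v ∉ U → ∀ a : Fin d → ℤ, ¬ Γ.Adj u (a +ᵥ v)

/-- A labeling of `Γ`: a periodic complex potential on the vertices and a periodic complex edge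
labeling. Edges are unoriented, so the edge labeling is symmetric by construction. -/
@[ext]
structure Labeling (d : ℕ) [AddAction (Fin d → ℤ) V] (Γ : SimpleGraph V) where
  pot : V → ℂ
  edge : Γ.edgeSet → ℂ
  pot_vadd : ∀ (a : Fin d → ℤ) (v : V), pot (a +ᵥ v) = pot v
  edge_vadd : ∀ (a : Fin d → ℤ) (e e' : Γ.edgeSet),
    e'.1 = Sym2.map (fun v => a +ᵥ v) e.1 → edge e' = edge e

/-- The coordinates on the space of labelings: one per vertex orbit and one per edge orbit.
They identify the space of labelings with an affine space. -/
def Labeling.coord (d : ℕ) [AddAction (Fin d → ℤ) V] (Γ : SimpleGraph V) :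
    Labeling d Γ ≃ (VertexOrbit d V ⊕ EdgeOrbit d Γ → ℂ) where
  toFun ℓ := Sum.elim
    (Quotient.lift ℓ.pot (by
      rintro _ v ⟨a, rfl⟩
      exact ℓ.pot_vadd a v))
    (Quotient.lift ℓ.edge (by
      rintro e e' ⟨a, h⟩
      exact (ℓ.edge_vadd a e e' h).symm))
  invFun x :=
    { pot := fun v => x (Sum.inl (Quotient.mk _ v))
      edge := fun e => x (Sum.inr (Quotient.mk _ e))
      pot_vadd := fun a v => congrArg (fun q => x (Sum.inl q)) (Quotient.sound ⟨a, rfl⟩)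
      edge_vadd := fun a e e' h =>
        (congrArg (fun q => x (Sum.inr q)) (Quotient.sound ⟨a, h⟩)).symm }
  left_inv ℓ := rfl
  right_inv x := by
    funext q
    rcases q with q | q <;> induction q using Quotient.inductionOn <;> rfl

/-- Algebraic subsets of the space of labelings: common zero sets of families of polynomials in
the coordinates. -/
def IsAlgebraicSet (d : ℕ) [AddAction (Fin d → ℤ) V] (Γ : SimpleGraph V)
    (S : Set (Labeling d Γ)) : Prop :=
  ∃ P : Set (MvPolynomial (VertexOrbit d V ⊕ EdgeOrbit d Γ) ℂ),
    S = {ℓ | ∀ p ∈ P, MvPolynomial.eval (Labeling.coord d Γ ℓ) p = 0}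

/-- A property of labelings is generic if it holds on a nonempty Zariski open set, i.e. outside a
proper algebraic set. -/
def IsGeneric (d : ℕ) [AddAction (Fin d → ℤ) V] (Γ : SimpleGraph V)
    (p : Labeling d Γ → Prop) : Prop :=
  ∃ S : Set (Labeling d Γ), IsAlgebraicSet d Γ S ∧ S ≠ Set.univ ∧ ∀ ℓ, ℓ ∉ S → p ℓ

/-- Laurent polynomials `ℂ[z₁^±, …, z_d^±]`, with `z^a` given by `AddMonoidAlgebra.single a 1`. -/
abbrev Laurent (d : ℕ) : Type := AddMonoidAlgebra ℂ (Fin d → ℤ)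

open Classical in
/-- The label `E((u,v))` if `(u,v)` is an edge, and `0` otherwise. -/
noncomputable def Labeling.weight {d : ℕ} [AddAction (Fin d → ℤ) V] {Γ : SimpleGraph V}
    (ℓ : Labeling d Γ) (u v : V) : ℂ :=
  if h : Γ.Adj u v then ℓ.edge ⟨s(u, v), h⟩ else 0

/-- For a periodic graph only finitely many `a` contribute to an entry of the Floquet matrix. -/
theorem IsPeriodic.finite_setOf_adj {d : ℕ} [AddAction (Fin d → ℤ) V] {Γ : SimpleGraph V}
    (h : IsPeriodic d Γ) (u v : V) : {a : Fin d → ℤ | Γ.Adj u (a +ᵥ v)}.Finite := by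
  classical
  have inj : ∀ (a b : Fin d → ℤ) (w : V), a +ᵥ w = b +ᵥ w → a = b := by
    intro a b w hab
    have : (-b + a) +ᵥ w = w := by rw [add_vadd, hab, neg_vadd_vadd]
    have := h.free _ _ this
    exact (neg_add_eq_zero.mp this).symm
  have := h.finite_edgeOrbit
  let f : {a : Fin d → ℤ // Γ.Adj u (a +ᵥ v)} → EdgeOrbit d Γ :=
    fun a => Quotient.mk (edgeSetoid d Γ) ⟨s(u, a.1 +ᵥ v), a.2⟩
  have key : Set.Finite (Set.univ : Set {a : Fin d → ℤ // Γ.Adj u (a +ᵥ v)}) := by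
    refine Set.Finite.of_finite_fibers f (Set.toFinite _) ?_
    rintro _ ⟨a₀, -, rfl⟩
    by_cases hc : ∃ c : Fin d → ℤ, u = c +ᵥ (a₀.1 +ᵥ v)
    · obtain ⟨c, hc⟩ := hc
      refine ((({a₀.1, c + c + a₀.1} : Set (Fin d → ℤ)).toFinite).preimage
        Subtype.val_injective.injOn).subset ?_
      rintro a ⟨-, ha⟩
      obtain ⟨b, hb⟩ := Quotient.exact (ha : f a = f a₀).symm
      simp only [Sym2.map_mk, Sym2.eq_iff] at hb
      rcases hb with ⟨h1, h2⟩ | ⟨h1, h2⟩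
      · have hb0 := h.free b u h1.symm
        left
        rw [hb0, zero_vadd] at h2
        exact inj _ _ _ h2
      · have hbc : c = b := inj _ _ _ (hc.symm.trans h1)
        right
        subst hbc
        have h3 : a.1 +ᵥ v = (c + c + a₀.1) +ᵥ v := by
          rw [h2, add_assoc, add_vadd, add_vadd, ← hc]
        exact inj _ _ _ h3
    · refine (Set.finite_singleton a₀).subset ?_
      rintro a ⟨-, ha⟩
      obtain ⟨b, hb⟩ := Quotient.exact (ha : f a = f a₀).symm
      simp only [Sym2.map_mk, Sym2.eq_iff] at hb
      rcases hb with ⟨h1, h2⟩ | ⟨h1, h2⟩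
      · have hb0 := h.free b u h1.symm
        rw [hb0, zero_vadd] at h2
        exact Subtype.ext (inj _ _ _ h2)
      · exact absurd ⟨b, h1⟩ hc
  exact Set.finite_coe_iff.mp (Set.finite_univ_iff.mp key)

open Classical in
/-- The Floquet matrix `L(z)` with respect to `W`:
`L(z)_{u,v} = δ_{u,v} V(u) + ∑_{a : (u,v+a) ∈ ℰ(Γ)} E((u,v+a)) z^a`. -/
noncomputable def Labeling.floquetMatrix {d : ℕ} [AddAction (Fin d → ℤ) V] {Γ : SimpleGraph V}
    (ℓ : Labeling d Γ) (W : Finset V) : Matrix W W (Laurent d) :=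
  fun u v => (if u = v then AddMonoidAlgebra.single 0 (ℓ.pot u) else 0) +
    ∑ᶠ a ∈ {a : Fin d → ℤ | Γ.Adj u (a +ᵥ (v : V))},
      AddMonoidAlgebra.single a (ℓ.weight u (a +ᵥ (v : V)))

open Classical in
/-- The dispersion polynomial `D(z,λ) = det (L(z) - λ I)`, a polynomial in `λ` with Laurent
polynomial coefficients. -/
noncomputable def Labeling.dispersion {d : ℕ} [AddAction (Fin d → ℤ) V] {Γ : SimpleGraph V}
    (ℓ : Labeling d Γ) (W : Finset V) : Polynomial (Laurent d) :=
  ((ℓ.floquetMatrix W).map Polynomial.C -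
    (Polynomial.X : Polynomial (Laurent d)) • (1 : Matrix W W (Polynomial (Laurent d)))).det

/-- `D(z,λ)` has a linear factor `λ - λ₀` with a constant `λ₀ ∈ ℂ` (a flat band). -/
def HasLinearFactor {d : ℕ} (D : Polynomial (Laurent d)) : Prop :=
  ∃ c : ℂ, (Polynomial.X - Polynomial.C (algebraMap ℂ (Laurent d) c)) ∣ D

end PeriodicGraph

/-!
A flat band is an eigenvalue of the Floquet matrix `L(z)` that is a constant.

If a fundamental domain has a nonempty component of support zero, the corresponding diagonal block
of `L(z)` has constant entries and so has a constant eigenvalue, whatever the labeling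
(`IsPeriodic.exists_isRoot_of_isComponent`). The choice of fundamental domain is immaterial, because
another choice conjugates `L(z)` by a diagonal matrix of monomials
(`IsPeriodic.charpoly_floquet_eq`).

Conversely, having a constant eigenvalue is a closed condition on the labeling
(`AddMonoidAlgebra.exists_eval_ne_zero_of_charpoly_not_isRoot`), so it suffices to show that a
component of support zero exists as soon as every labeling has a flat band. Let all edge labels be
`1` and let the potential `V` take values in `ℕ`. The finite set `Λ(V)` of constant eigenvalues
satisfies `Λ(V + s) = Λ(V) + s`, so it is not insensitive to all coordinates of `V`: for some `V` and
some vertex `u`, infinitely many of the sets `Λ(V + s e_u)` contain an element `c` outside `Λ(V)`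
(`exists_infinite_not_subset_update`). As `det (c - L)` depends linearly on the potential at `u`, for
each such `c` it is a constant multiple of the cofactor of `c - L` at `u`. Infinitely many values `c`
force the ratio of the two, a rational function of `c`, to be independent of `z`. Expanded in `1/c`
this ratio generates the entries `(Lᵏ)_{u,u}`, so all of these are independent of `z`
(`Matrix.pow_apply_eq_algebraMap_of_infinite`). Now `L` has coefficients in `ℕ`, so a walk in `Γ`
from `u` to `u + a` gives a nonzero coefficient of `z^a` in some `(Lᵏ)_{u,u}`; hence `u` is connected
to `u + a` only for `a = 0`, and the connected component of `u` in `Γ` is a component of support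
zero of a suitable fundamental domain (`IsPeriodic.exists_isComponent_of_reachable`).
-/

/-! ### Diagonal perturbations of a matrix -/

theorem Matrix.det_add_single_diag {n R : Type*} [Fintype n] [DecidableEq n] [CommRing R]
    (A : Matrix n n R) (u : n) (s : R) :
    (A + Matrix.single u u s).det = A.det + s * A.adjugate u u := by
  have h : A + Matrix.single u u s = A.updateRow u (A u + s • Pi.single u 1) := by
    ext i j
    by_cases hi : i = u
    · subst hi
      by_cases hj : j = i
      · subst hj; simp
      · simp [hj, Ne.symm hj]
    · simp [Matrix.updateRow_ne hi, Ne.symm hi]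
  rw [h, Matrix.det_updateRow_add, Matrix.det_updateRow_smul, Matrix.updateRow_eq_self,
    Matrix.adjugate_apply]

open Polynomial in
/-- The identity `adj (1 - X M) = det (1 - X M) * ∑ₖ Xᵏ Mᵏ`, read entrywise in power series: the
ratio of a cofactor of `1 - X M` to its determinant generates the entries of the powers of `M`. -/
theorem Matrix.coe_adjugate_one_sub_X_smul {n R : Type*} [Fintype n] [DecidableEq n] [CommRing R]
    (M : Matrix n n R) (u v : n) :
    (((1 - (X : R[X]) • M.map C).adjugate u v : R[X]) : PowerSeries R) =
      (M.charpolyRev : PowerSeries R) * PowerSeries.mk (fun k => (M ^ k) u v) := by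
  set φ : R[X] →+* PowerSeries R := Polynomial.coeToPowerSeries.ringHom
  set N : Matrix n n R[X] := 1 - (X : R[X]) • M.map C
  set G : Matrix n n (PowerSeries R) := Matrix.of fun i j => PowerSeries.mk fun k => (M ^ k) i j
  have hG : φ.mapMatrix N * G = 1 := by
    have : φ.mapMatrix N = 1 - (PowerSeries.X : PowerSeries R) • M.map PowerSeries.C := by
      ext1 i j
      simp [N, φ, Matrix.one_apply, apply_ite (Polynomial.toPowerSeries (R := R))]
      exact mul_comm _ _
    rw [this, sub_mul, one_mul, smul_mul_assoc]
    ext i j k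
    rcases k with _ | k
    · simp [G, Matrix.one_apply, apply_ite (PowerSeries.coeff (R := R) 0)]
    · rw [Matrix.sub_apply, map_sub, Matrix.smul_apply, smul_eq_mul, PowerSeries.coeff_succ_X_mul,
        Matrix.mul_apply, map_sum]
      simp [G, Matrix.one_apply, pow_succ', Matrix.mul_apply,
        apply_ite (PowerSeries.coeff (R := R) (k+1)), PowerSeries.coeff_one]
  have h2 : φ.mapMatrix N.adjugate = φ N.det • G := by
    have : φ.mapMatrix N.adjugate * (φ.mapMatrix N * G) = φ N.det • G := by
      rw [← mul_assoc, ← map_mul, Matrix.adjugate_mul]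
      have : φ.mapMatrix (N.det • (1 : Matrix n n R[X])) = φ N.det • 1 := by
        ext1 i j
        simp [Matrix.one_apply, apply_ite φ]
      rw [this, smul_mul_assoc, one_mul]
    rwa [hG, mul_one] at this
  have := congrFun (congrFun h2 u) v
  simpa [G, φ, Matrix.charpolyRev] using this

open Polynomial in
/-- If `det (c - M)` is a constant multiple of the cofactor `adj (c - M) u u` for infinitely many
constants `c`, then the ratio of the two, as a function of `c`, has constant coefficients, and hence
so do the entries `(M ^ k) u u` that it generates. Here "constant" means lying in the image of `ℂ`,
and `ε` is an arbitrary specialization to constants. -/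
theorem Matrix.pow_apply_eq_algebraMap_of_infinite {n B : Type*} [Fintype n] [DecidableEq n]
    [CommRing B] [IsDomain B] [Algebra ℂ B] (ε : B →ₐ[ℂ] ℂ) (M : Matrix n n B) (u : n)
    (hinf : {c : ℂ | ∃ s : ℂ, (Matrix.scalar n (algebraMap ℂ B c) - M).det =
      algebraMap ℂ B s * (Matrix.scalar n (algebraMap ℂ B c) - M).adjugate u u}.Infinite) (k : ℕ) :
    (M ^ k) u u = algebraMap ℂ B (ε ((M ^ k) u u)) := by
  set N := M.charpolyRev
  set A : B[X] := (1 - (X : B[X]) • M.map C).adjugate u u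
  -- `ρ` replaces an element by its specialization, so its fixed points are constants.
  set ρ : B →+* B := (algebraMap ℂ B).comp ε.toRingHom with hρ
  have hρa (c : ℂ) : ρ (algebraMap ℂ B c) = algebraMap ℂ B c := by simp [ρ]
  have key : A * N.map ρ = N * A.map ρ := by
    rw [← sub_eq_zero]
    apply Polynomial.eq_zero_of_infinite_isRoot
    have hinj : Function.Injective (fun c : ℂ => algebraMap ℂ B c⁻¹) :=
      (algebraMap ℂ B).injective.comp inv_injective
    -- The roots are the inverses of the given constants, since `1 - c⁻¹ M = c⁻¹ (c - M)`.
    refine ((hinf.sdiff (Set.finite_singleton 0)).image hinj.injOn).mono ?_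
    rintro _ ⟨c, ⟨⟨s, hs⟩, hc⟩, rfl⟩
    have hc : c ≠ 0 := hc
    set μ := algebraMap ℂ B c⁻¹ with hμ
    have hμc : μ * algebraMap ℂ B c = 1 := by rw [hμ, ← map_mul, inv_mul_cancel₀ hc, map_one]
    have hM : (evalRingHom μ).mapMatrix (1 - (X : B[X]) • M.map C) =
        μ • (Matrix.scalar n (algebraMap ℂ B c) - M) := by
      ext i j
      by_cases hij : i = j
      · subst hij; simp [mul_sub, hμc]; exact mul_comm _ _
      · simp [hij]; exact mul_comm _ _
    have hN : N.eval μ = μ ^ Fintype.card n * (Matrix.scalar n (algebraMap ℂ B c) - M).det := by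
      rw [← Matrix.det_smul, ← hM, ← RingHom.map_det]; rfl
    have hA : A.eval μ = μ ^ (Fintype.card n - 1) *
        (Matrix.scalar n (algebraMap ℂ B c) - M).adjugate u u := by
      have : A.eval μ = ((evalRingHom μ).mapMatrix (1 - (X : B[X]) • M.map C)).adjugate u u := by
        rw [← RingHom.map_adjugate]; rfl
      rw [this, hM, Matrix.adjugate_smul]; rfl
    have hcard : μ ^ Fintype.card n = μ * μ ^ (Fintype.card n - 1) := by
      rw [← pow_succ', Nat.sub_add_cancel (Fintype.card_pos_iff.2 ⟨u⟩)]
    have hNA : N.eval μ = algebraMap ℂ B (c⁻¹ * s) * A.eval μ := by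
      rw [hN, hA, hs, hcard, map_mul]; ring
    have hev (p : B[X]) : (p.map ρ).eval μ = ρ (p.eval μ) := by
      rw [hμ, ← hρa, Polynomial.eval_map_apply, hρa]
    change (A * N.map ρ - N * A.map ρ).eval μ = 0
    rw [eval_sub, eval_mul, eval_mul, hev, hev, hNA, map_mul, hρa]; ring
  set g : PowerSeries B := PowerSeries.mk fun k => (M ^ k) u u
  have hg : (A : PowerSeries B) = N * g := M.coe_adjugate_one_sub_X_smul u u
  have hmap (p : B[X]) : ((p.map ρ : B[X]) : PowerSeries B) = PowerSeries.map ρ p := by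
    ext i; simp
  have key' := congrArg (Polynomial.toPowerSeries (R := B)) key
  rw [Polynomial.coe_mul, Polynomial.coe_mul, hmap, hmap, hg, map_mul] at key'
  have hN1 : PowerSeries.constantCoeff (R := B) (N : PowerSeries B) = 1 := by
    have := M.eval_charpolyRev
    rw [← Polynomial.coeff_zero_eq_eval_zero] at this
    rw [← PowerSeries.coeff_zero_eq_constantCoeff_apply, Polynomial.coeff_coe]; exact this
  have hN0 : (N : PowerSeries B) ≠ 0 := fun h => by simp [h] at hN1
  have hN0' : PowerSeries.map ρ (N : PowerSeries B) ≠ 0 := fun h => by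
    have h2 : PowerSeries.constantCoeff (PowerSeries.map ρ (N : PowerSeries B)) = 1 := by
      rw [← PowerSeries.coeff_zero_eq_constantCoeff_apply, PowerSeries.coeff_map,
        PowerSeries.coeff_zero_eq_constantCoeff_apply, hN1, map_one]
    simp [h] at h2
  -- Both `g` and its specialization equal the specialized ratio of `A` to `N`.
  have : g = PowerSeries.map ρ g := by
    apply mul_left_cancel₀ (mul_ne_zero hN0 hN0')
    linear_combination key'
  have := congrArg (PowerSeries.coeff k) this
  simpa [g, ρ] using this

/-- If changing one coordinate of `V` yielded a subset of `F V` for all but finitely many values of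
that coordinate, then `V` and `V'` could be changed one coordinate at a time into a common `w`, with
the same new value avoiding both finite exceptional sets at every step; but then
`F w ⊆ F V ∩ F V' = ∅`. -/
theorem exists_infinite_not_subset_update {n α : Type*} [Finite n] [DecidableEq n]
    (F : (n → ℕ) → Set α) (hne : ∀ V, (F V).Nonempty)
    (hdisj : ∃ V V', Disjoint (F V) (F V')) :
    ∃ V u, {m : ℕ | ¬ F (Function.update V u m) ⊆ F V}.Infinite := by
  by_contra! hfin
  obtain ⟨V, V', hVV⟩ := hdisj
  have := Fintype.ofFinite n
  have step : ∀ T : Finset n, ∃ w w' : n → ℕ, F w ⊆ F V ∧ F w' ⊆ F V' ∧ ∀ u ∈ T, w u = w' u := by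
    intro T
    induction T using Finset.induction_on with
    | empty => exact ⟨V, V', subset_rfl, subset_rfl, by simp⟩
    | insert u T hu ih =>
      obtain ⟨w, w', h, h', hT⟩ := ih
      have hf := (hfin w u).union (hfin w' u)
      obtain ⟨m, hm⟩ := hf.exists_notMem
      simp only [Set.mem_union, Set.mem_ofPred_eq, not_or, not_not] at hm
      refine ⟨_, _, hm.1.trans h, hm.2.trans h', fun v hv => ?_⟩
      by_cases hvu : v = u
      · subst hvu; simp
      · simp [hvu, hT v (Finset.mem_of_mem_insert_of_ne hv hvu)]
  obtain ⟨w, w', h, h', hw⟩ := step Finset.univ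
  obtain rfl : w = w' := funext fun u => hw u (Finset.mem_univ u)
  obtain ⟨x, hx⟩ := hne w
  exact Set.disjoint_left.1 hVV (h hx) (h' hx)

/-- If every matrix `M + diag V` with `V` a vector of natural numbers has a constant eigenvalue,
then for one of them, and some `u`, the `(u, u)` entries of all powers are constant. The reason is
that the constant eigenvalues of `M + diag V` cannot all be insensitive to each coordinate of `V`,
as they shift along with `V`. Natural numbers are used so that no cancellation can occur in the
powers of `M + diag V` when `M` has nonnegative coefficients. -/
theorem Matrix.exists_pow_apply_eq_algebraMap {n B : Type*} [Fintype n] [DecidableEq n]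
    [CommRing B] [IsDomain B] [Algebra ℂ B] (ε : B →ₐ[ℂ] ℂ) (M : Matrix n n B)
    (hM : ∀ V : n → ℕ, ∃ c : ℂ, (Matrix.scalar n (algebraMap ℂ B c) -
      (M + Matrix.diagonal fun w => (V w : B))).det = 0) :
    ∃ (V : n → ℕ) (u : n), ∀ k, ∃ c : ℂ,
      ((M + Matrix.diagonal fun w => (V w : B)) ^ k) u u = algebraMap ℂ B c := by
  set MV : (n → ℕ) → Matrix n n B := fun V => M + Matrix.diagonal fun w => (V w : B) with hMV
  set F : (n → ℕ) → Set ℂ := fun V => {c | (Matrix.scalar n (algebraMap ℂ B c) - MV V).det = 0}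
    with hF
  have hFfin : (F 0).Finite := by
    have h0 : (MV 0).charpoly ≠ 0 := (Matrix.charpoly_monic _).ne_zero
    refine ((Polynomial.finite_setOfPred_isRoot h0).preimage
      (algebraMap ℂ B).injective.injOn).subset fun c hc => ?_
    simp only [Set.mem_preimage, Set.mem_ofPred_eq, Polynomial.IsRoot, Matrix.eval_charpoly]
    exact hc
  have hshift (s : ℕ) (c : ℂ) : c ∈ F (fun _ => s) ↔ c - s ∈ F 0 := by
    simp only [hF, hMV, Set.mem_ofPred_eq]
    have : Matrix.scalar n (algebraMap ℂ B c) - (M + Matrix.diagonal fun _ => (s : B)) =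
        Matrix.scalar n (algebraMap ℂ B (c - s)) -
          (M + Matrix.diagonal fun w => (((0 : n → ℕ) w : ℕ) : B)) := by
      ext i j
      by_cases hij : i = j
      · subst hij; simp; ring
      · simp [hij]
    rw [this]
  have hdisj : ∃ V V', Disjoint (F V) (F V') := by
    have hD : (Set.image2 (fun x y => x - y) (F 0) (F 0)).Finite := hFfin.image2 _ hFfin
    obtain ⟨s, hs⟩ := (hD.preimage (Nat.cast_injective (R := ℂ)).injOn).exists_notMem
    refine ⟨fun _ => s, 0, Set.disjoint_left.2 fun c hc hc0 => hs ?_⟩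
    exact ⟨c, hc0, c - s, (hshift s c).1 hc, by ring⟩
  obtain ⟨V, u, hinf⟩ := exists_infinite_not_subset_update F hM hdisj
  refine ⟨V, u, fun k => ⟨_, Matrix.pow_apply_eq_algebraMap_of_infinite ε (MV V) u ?_ k⟩⟩
  have hex : ∀ m ∈ {m : ℕ | ¬ F (Function.update V u m) ⊆ F V},
      ∃ c, c ∈ F (Function.update V u m) ∧ c ∉ F V := fun m hm => Set.not_subset.1 hm
  choose! c hc hc' using hex
  -- The `(u, u)` entry enters the determinant linearly, with the cofactor as coefficient.
  have hdet (m : ℕ) (hm : m ∈ {m : ℕ | ¬ F (Function.update V u m) ⊆ F V}) :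
      (Matrix.scalar n (algebraMap ℂ B (c m)) - MV V).det =
      algebraMap ℂ B (m - V u) *
        (Matrix.scalar n (algebraMap ℂ B (c m)) - MV V).adjugate u u := by
    have h1 : Matrix.scalar n (algebraMap ℂ B (c m)) - MV (Function.update V u m) =
        (Matrix.scalar n (algebraMap ℂ B (c m)) - MV V) +
          Matrix.single u u (algebraMap ℂ B (V u - m)) := by
      ext i j
      by_cases hij : i = j
      · subst hij
        by_cases hi : i = u
        · subst hi; simp [hMV]; ring
        · simp [hMV, hi, Ne.symm hi]
      · have : ¬ (u = i ∧ u = j) := fun h => hij (h.1.symm.trans h.2)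
        simp [hMV, hij, Matrix.single_apply_of_ne _ _ _ _ _ this]
    have h2 := hc m hm
    simp only [hF, Set.mem_ofPred_eq, h1, Matrix.det_add_single_diag] at h2
    rw [eq_neg_of_add_eq_zero_left h2, ← neg_mul, ← map_neg, neg_sub]
  -- The cofactor does not vanish at `c m`, so `c m` determines `m`.
  refine (hinf.image (f := c) ?_).mono ?_
  · intro m hm m' hm' h
    have e1 := hdet m hm
    have e2 := hdet m' hm'
    rw [← h] at e2
    have hA : (Matrix.scalar n (algebraMap ℂ B (c m)) - MV V).adjugate u u ≠ 0 := by
      intro h0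
      rw [h0, mul_zero] at e1
      exact hc' m hm e1
    have := mul_right_cancel₀ hA (e1.symm.trans e2)
    have := (algebraMap ℂ B).injective this
    simpa using this
  · rintro _ ⟨m, hm, rfl⟩
    exact ⟨_, hdet m hm⟩

/-! ### Constant eigenvalues as a closed condition -/

namespace AddMonoidAlgebra

variable {R S G : Type*}

section

variable [CommSemiring R] [CommSemiring S]

/-- The polynomial over `R` obtained from a polynomial over `R[G]` by extracting the coefficient
of `a : G` from each of its coefficients. -/
noncomputable def coeffPoly [AddMonoid G] (a : G) (p : Polynomial (AddMonoidAlgebra R G)) :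
    Polynomial R :=
  ∑ k ∈ Finset.range (p.natDegree + 1), Polynomial.monomial k ((p.coeff k).coeff a)

theorem coeff_coeffPoly [AddMonoid G] (a : G) (p : Polynomial (AddMonoidAlgebra R G)) (k : ℕ) :
    (coeffPoly a p).coeff k = (p.coeff k).coeff a := by
  simp only [coeffPoly, Polynomial.finsetSum_coeff, Polynomial.coeff_monomial]
  rw [Finset.sum_ite_eq' _ k]
  split_ifs with hk
  · rfl
  · rw [Polynomial.coeff_eq_zero_of_natDegree_lt (by simpa using hk)]; rfl

theorem coeffPoly_map [AddMonoid G] (φ : R →+* S) (a : G) (p : Polynomial (AddMonoidAlgebra R G)) :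
    coeffPoly a (p.map (mapRingHom G φ)) = (coeffPoly a p).map φ := by
  ext k
  simp [coeff_coeffPoly]

theorem coeff_eval_algebraMap [AddCommMonoid G] (a : G) (p : Polynomial (AddMonoidAlgebra R G))
    (c : R) : (p.eval (algebraMap R _ c)).coeff a = (coeffPoly a p).eval c := by
  simp only [coeffPoly, Polynomial.eval_finsetSum, Polynomial.eval_monomial]
  rw [Polynomial.eval_eq_sum_range, coeff_sum, Finsupp.finsetSum_apply]
  refine Finset.sum_congr rfl fun k _ => ?_
  rw [← map_pow, mul_comm, ← Algebra.smul_def, coeff_smul, Finsupp.smul_apply, smul_eq_mul,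
    mul_comm]

/-- The augmentation homomorphism `R[G] → R`, sending every monomial `single a 1` to `1`. -/
noncomputable def augmentation (R G : Type*) [CommSemiring R] [AddCommMonoid G] :
    AddMonoidAlgebra R G →ₐ[R] R :=
  AddMonoidAlgebra.lift R R G 1

theorem augmentation_mapRingHom [AddCommMonoid G] (φ : R →+* S) (x : AddMonoidAlgebra R G) :
    augmentation S G (mapRingHom G φ x) = φ (augmentation R G x) := by
  have : ((augmentation S G).toRingHom.comp (mapRingHom G φ)) =
      φ.comp (augmentation R G).toRingHom := by
    ext <;> simp [augmentation]
  exact RingHom.congr_fun this x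

end

/-- Having a constant eigenvalue is a closed condition: if the specialization of `M` at one point
`φ₀` has none, then some `P : R` does not vanish at `φ₀` but vanishes at all points where the
specialization of `M` has one. A point `c` is a constant eigenvalue exactly when it is a common
root of the coefficient polynomials of the characteristic polynomial. At `φ₀` these satisfy a
Bézout identity; the same combination `Q` over `R`, applied to the matrix obtained from `M` by
setting all monomials to `1`, gives a matrix whose determinant is `P`. -/
theorem exists_eval_ne_zero_of_charpoly_not_isRoot {n : Type*} [Fintype n] [DecidableEq n]
    [AddCommMonoid G] [CommRing R] [Algebra ℂ R] (M : Matrix n n (AddMonoidAlgebra R G))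
    (φ₀ : R →ₐ[ℂ] ℂ)
    (h₀ : ∀ c : ℂ, ¬ (M.map (mapRingHom G φ₀.toRingHom)).charpoly.IsRoot (algebraMap ℂ _ c)) :
    ∃ P : R, φ₀ P ≠ 0 ∧ ∀ φ : R →ₐ[ℂ] ℂ,
      (∃ c : ℂ, (M.map (mapRingHom G φ.toRingHom)).charpoly.IsRoot (algebraMap ℂ _ c)) →
        φ P = 0 := by
  have hp (φ : R →ₐ[ℂ] ℂ) (c : ℂ) :
      (M.map (mapRingHom G φ.toRingHom)).charpoly.IsRoot (algebraMap ℂ _ c) ↔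
        ∀ a, ((coeffPoly a M.charpoly).map φ.toRingHom).eval c = 0 := by
    simp only [Polynomial.IsRoot, Matrix.charpoly_map, ← coeffPoly_map, ← coeff_eval_algebraMap]
    constructor
    · intro h a; rw [h]; rfl
    · intro h; ext a; simpa using h a
  have htop : Ideal.span (Set.range fun a => (coeffPoly a M.charpoly).map φ₀.toRingHom) = ⊤ := by
    set I := Ideal.span (Set.range fun a => (coeffPoly a M.charpoly).map φ₀.toRingHom)
    obtain ⟨g, hg⟩ := (IsPrincipalIdealRing.principal I).principal
    by_contra hI
    have hroot : ∃ c, g.eval c = 0 := by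
      by_cases hg0 : g.degree = 0
      · refine absurd ?_ hI
        rw [hg]
        exact Ideal.span_singleton_eq_top.2 (Polynomial.isUnit_iff_degree_eq_zero.2 hg0)
      · exact IsAlgClosed.exists_root g hg0
    obtain ⟨c, hc⟩ := hroot
    refine h₀ c ((hp φ₀ c).2 fun a => ?_)
    have : (coeffPoly a M.charpoly).map φ₀.toRingHom ∈ I := Ideal.subset_span ⟨a, rfl⟩
    rw [hg] at this
    obtain ⟨r, hr⟩ := Ideal.mem_span_singleton.1 this
    rw [hr, Polynomial.eval_mul, hc, zero_mul]
  obtain ⟨q, hq⟩ := Finsupp.mem_ideal_span_range_iff_exists_finsupp.1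
    ((Ideal.eq_top_iff_one _).1 htop)
  set Q : Polynomial R := q.sum fun a r => r.map (algebraMap ℂ R) * coeffPoly a M.charpoly
  have hQ (φ : R →ₐ[ℂ] ℂ) : Q.map φ.toRingHom =
      q.sum fun a r => r * (coeffPoly a M.charpoly).map φ.toRingHom := by
    have : φ.toRingHom.comp (algebraMap ℂ R) = RingHom.id ℂ := by ext x; simp
    simp only [Q, Finsupp.sum, Polynomial.map_sum, Polynomial.map_mul, Polynomial.map_map, this,
      Polynomial.map_id]
  set N : Matrix n n R := M.map (augmentation R G)
  have hdet (φ : R →ₐ[ℂ] ℂ) : φ (Polynomial.aeval N Q).det =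
      (Polynomial.aeval (N.map φ) (Q.map φ.toRingHom)).det := by
    rw [← AlgHom.coe_toRingHom, RingHom.map_det, Polynomial.aeval_def, Polynomial.hom_eval₂,
      Polynomial.aeval_def, Polynomial.eval₂_map]
    congr 2
    ext x i j
    by_cases hij : i = j <;> simp [Matrix.algebraMap_matrix_apply, hij]
  refine ⟨(Polynomial.aeval N Q).det, ?_, ?_⟩
  · rw [hdet, hQ, hq]; simp
  · rintro φ ⟨c, hc⟩
    have hQc : (Q.map φ.toRingHom).IsRoot c := by
      rw [Polynomial.IsRoot, hQ, Finsupp.sum, Polynomial.eval_finsetSum]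
      exact Finset.sum_eq_zero fun a _ => by rw [Polynomial.eval_mul, (hp φ c).1 hc a, mul_zero]
    obtain ⟨r, hr⟩ := Polynomial.dvd_iff_isRoot.2 hQc
    have hN : N.map φ = (M.map (mapRingHom G φ.toRingHom)).map (augmentation ℂ G).toRingHom := by
      ext i j
      simpa [N] using (augmentation_mapRingHom φ.toRingHom (M i j)).symm
    have hroot : (N.map φ).charpoly.IsRoot c := by
      rw [hN, Matrix.charpoly_map]
      have := hc.map (f := (augmentation ℂ G).toRingHom)
      rwa [AlgHom.toRingHom_eq_coe, AlgHom.coe_toRingHom, AlgHom.commutes] at this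
    have h0 : (N.map φ - Matrix.scalar n c).det = 0 := by
      rw [Polynomial.IsRoot, Matrix.eval_charpoly] at hroot
      rw [← neg_sub, Matrix.det_neg, hroot, mul_zero]
    rw [hdet, hr, map_mul, Matrix.det_mul]
    have : Polynomial.aeval (N.map φ) (Polynomial.X - Polynomial.C c) =
        N.map φ - Matrix.scalar n c := by
      simp; rfl
    rw [this, h0, zero_mul]

end AddMonoidAlgebra

namespace PeriodicGraph

open AddMonoidAlgebra (mapRingHom augmentation)

variable {d : ℕ} {V : Type*} [AddAction (Fin d → ℤ) V] {Γ : SimpleGraph V}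

theorem IsPeriodic.adj_vadd_iff (hΓ : IsPeriodic d Γ) (a : Fin d → ℤ) {u v : V} :
    Γ.Adj (a +ᵥ u) (a +ᵥ v) ↔ Γ.Adj u v :=
  ⟨fun h => by simpa using hΓ.adj_vadd (-a) _ _ h, hΓ.adj_vadd a u v⟩

/-! ### Fundamental domains -/

section FundamentalDomain

variable {W : Finset V}

theorem IsFundamentalDomain.bijective_mk (hΓ : IsPeriodic d Γ) (hW : IsFundamentalDomain d W) :
    Function.Bijective (fun w : W => (Quotient.mk _ w.1 : VertexOrbit d V)) := by
  have := hΓ.finite_vertexOrbit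
  have := Fintype.ofFinite (VertexOrbit d V)
  rw [Fintype.bijective_iff_surjective_and_card]
  constructor
  · intro q
    induction q using Quotient.inductionOn with
    | h v =>
      obtain ⟨w, hw, a, rfl⟩ := hW.1 v
      exact ⟨⟨w, hw⟩, (Quotient.sound (s := AddAction.orbitRel _ V) ⟨a, rfl⟩).symm⟩
  · rw [Fintype.card_coe, hW.2, Nat.card_eq_fintype_card]

theorem IsFundamentalDomain.eq_of_vadd_eq (hΓ : IsPeriodic d Γ) (hW : IsFundamentalDomain d W)
    {u v : V} (hu : u ∈ W) (hv : v ∈ W) {a b : Fin d → ℤ} (h : a +ᵥ u = b +ᵥ v) : u = v := by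
  have : u = (-a + b) +ᵥ v := by rw [add_vadd, ← h, neg_vadd_vadd]
  exact congrArg Subtype.val ((hW.bijective_mk hΓ).1 (a₁ := ⟨u, hu⟩) (a₂ := ⟨v, hv⟩)
    (Quotient.sound ⟨-a + b, this.symm⟩))

end FundamentalDomain

/-! ### Floquet matrices over an arbitrary coefficient semiring -/

section Floquet

variable {R S : Type*} [CommSemiring R] [CommSemiring S]

open Classical in
/-- The coefficient of `z^a` in the `(u, v)` entry of the Floquet matrix, for labels `y` given by
their values on vertex orbits and edge orbits. -/
noncomputable def floquetCoeff (y : VertexOrbit d V ⊕ EdgeOrbit d Γ → R) (u v : V)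
    (a : Fin d → ℤ) : R :=
  (if u = v ∧ a = 0 then y (Sum.inl (Quotient.mk _ u)) else 0) +
    if h : Γ.Adj u (a +ᵥ v) then y (Sum.inr (Quotient.mk _ ⟨s(u, a +ᵥ v), h⟩)) else 0

theorem floquetCoeff_eq_zero (y : VertexOrbit d V ⊕ EdgeOrbit d Γ → R) {u v : V}
    {a : Fin d → ℤ} (h : ¬ (u = v ∧ a = 0)) (h' : ¬ Γ.Adj u (a +ᵥ v)) :
    floquetCoeff y u v a = 0 := by
  simp [floquetCoeff, h, h']

theorem IsPeriodic.finite_support_floquetCoeff (hΓ : IsPeriodic d Γ)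
    (y : VertexOrbit d V ⊕ EdgeOrbit d Γ → R) (u v : V) :
    (Function.support (floquetCoeff y u v)).Finite := by
  refine ((Set.finite_singleton 0).union (hΓ.finite_setOf_adj u v)).subset fun a ha => ?_
  by_contra h
  rw [Set.mem_union, not_or] at h
  exact ha (floquetCoeff_eq_zero y (fun h' => h.1 h'.2) h.2)

/-- Translating the vertices shifts the exponents. The hypotheses say that `u` and `v` are equal or
in different orbits, and that equal vertices are translated equally, as is the case for vertices of
a fundamental domain; they are needed for the diagonal term. -/
theorem IsPeriodic.floquetCoeff_vadd (hΓ : IsPeriodic d Γ)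
    (y : VertexOrbit d V ⊕ EdgeOrbit d Γ → R) {u v : V} {b b' : Fin d → ℤ}
    (h : u = v → b = b') (h' : b +ᵥ u = b' +ᵥ v → u = v) (a : Fin d → ℤ) :
    floquetCoeff y (b +ᵥ u) (b' +ᵥ v) a = floquetCoeff y u v (-b + a + b') := by
  have hv : a +ᵥ (b' +ᵥ v) = b +ᵥ ((-b + a + b') +ᵥ v) := by
    simp only [← add_vadd]; congr 1; abel
  have h1 : (b +ᵥ u = b' +ᵥ v ∧ a = 0) ↔ (u = v ∧ -b + a + b' = 0) := by
    constructor
    · rintro ⟨h1, rfl⟩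
      have := h' h1
      refine ⟨this, ?_⟩
      rw [h this]; abel
    · rintro ⟨rfl, h2⟩
      have := h rfl
      subst this
      exact ⟨rfl, by simpa using h2⟩
  have h2 : Γ.Adj (b +ᵥ u) (a +ᵥ (b' +ᵥ v)) ↔ Γ.Adj u ((-b + a + b') +ᵥ v) := by
    rw [hv, hΓ.adj_vadd_iff]
  have h3 : (Quotient.mk _ (b +ᵥ u) : VertexOrbit d V) = Quotient.mk _ u :=
    Quotient.sound ⟨b, rfl⟩
  unfold floquetCoeff
  congr 1
  · rw [h3]
    classical exact if_congr h1 rfl rfl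
  · by_cases hadj : Γ.Adj u ((-b + a + b') +ᵥ v)
    · rw [dif_pos hadj, dif_pos (h2.2 hadj)]
      refine congrArg (fun q => y (Sum.inr q)) (Quotient.sound ?_).symm
      refine ⟨b, ?_⟩
      simp only [Sym2.map_mk, hv]
    · rw [dif_neg hadj, dif_neg (fun h => hadj (h2.1 h))]

/-- The Floquet matrix with labels in a commutative semiring `R`. Besides `ℂ`, it is used for
polynomial rings (generic labels) and for `ℕ` (where no cancellation occurs). -/
noncomputable def IsPeriodic.floquet (hΓ : IsPeriodic d Γ)
    (y : VertexOrbit d V ⊕ EdgeOrbit d Γ → R) (W : Finset V) :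
    Matrix W W (AddMonoidAlgebra R (Fin d → ℤ)) :=
  fun u v => .ofCoeff (Finsupp.ofSupportFinite _ (hΓ.finite_support_floquetCoeff y u v))

theorem IsPeriodic.coeff_floquet (hΓ : IsPeriodic d Γ)
    (y : VertexOrbit d V ⊕ EdgeOrbit d Γ → R) (W : Finset V) (u v : W) (a : Fin d → ℤ) :
    (hΓ.floquet y W u v).coeff a = floquetCoeff y u v a := rfl

theorem IsPeriodic.floquet_map (hΓ : IsPeriodic d Γ) (φ : R →+* S)
    (y : VertexOrbit d V ⊕ EdgeOrbit d Γ → R) (W : Finset V) :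
    (hΓ.floquet y W).map (mapRingHom _ φ) = hΓ.floquet (φ ∘ y) W := by
  ext u v a
  rw [Matrix.map_apply, AddMonoidAlgebra.coeff_mapRingHom, coeff_floquet, coeff_floquet]
  unfold floquetCoeff
  split_ifs <;> simp

end Floquet

theorem IsPeriodic.floquetMatrix_eq (hΓ : IsPeriodic d Γ) (ℓ : Labeling d Γ) (W : Finset V) :
    ℓ.floquetMatrix W = hΓ.floquet (Labeling.coord d Γ ℓ) W := by
  classical
  ext u v a
  rw [coeff_floquet, Labeling.floquetMatrix,
    finsum_mem_eq_finite_toFinset_sum _ (hΓ.finite_setOf_adj u v)]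
  rw [AddMonoidAlgebra.coeff_add, Finsupp.add_apply, AddMonoidAlgebra.coeff_sum,
    Finsupp.finsetSum_apply, floquetCoeff]
  congr 1
  · by_cases h : u = v
    · subst h
      by_cases ha : a = 0
      · subst ha; simp; rfl
      · simp [ha]
    · have : ¬ (u.1 = v.1) := fun h' => h (Subtype.ext h')
      simp [h, this]
  · simp only [AddMonoidAlgebra.coeff_single, Finsupp.single_apply, Finset.sum_ite_eq',
      Set.Finite.mem_toFinset]
    by_cases h : Γ.Adj u (a +ᵥ (v : V))
    · simp [h, Labeling.weight]; rfl
    · simp [h]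

open Classical in
/-- A linear factor of the dispersion polynomial is a constant eigenvalue of the Floquet matrix. -/
theorem IsPeriodic.hasLinearFactor_dispersion_iff (hΓ : IsPeriodic d Γ) (ℓ : Labeling d Γ)
    (W : Finset V) : HasLinearFactor (ℓ.dispersion W) ↔
      ∃ c : ℂ, (hΓ.floquet (Labeling.coord d Γ ℓ) W).charpoly.IsRoot (algebraMap ℂ _ c) := by
  refine exists_congr fun c => ?_
  rw [Polynomial.dvd_iff_isRoot, ← hΓ.floquetMatrix_eq]
  have : ℓ.dispersion W = (-1) ^ Fintype.card W * (ℓ.floquetMatrix W).charpoly := by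
    rw [Labeling.dispersion, Matrix.charpoly, Matrix.charmatrix, ← Matrix.det_neg, neg_sub]
    congr 2
    ext1 i j
    simp [Matrix.one_apply, Matrix.diagonal_apply]
  rw [this]
  simp [Polynomial.IsRoot]

open Classical in
/-- Up to reindexing, the Floquet matrices of two fundamental domains are conjugate by a diagonal
matrix of monomials. -/
theorem IsPeriodic.charpoly_floquet_eq {R : Type*} [CommRing R] (hΓ : IsPeriodic d Γ)
    (y : VertexOrbit d V ⊕ EdgeOrbit d Γ → R) {W W' : Finset V} (hW : IsFundamentalDomain d W)
    (hW' : IsFundamentalDomain d W') :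
    (hΓ.floquet y W').charpoly = (hΓ.floquet y W).charpoly := by
  set e : W ≃ W' := (Equiv.ofBijective _ (hW.bijective_mk hΓ)).trans
    (Equiv.ofBijective _ (hW'.bijective_mk hΓ)).symm
  have he (w : W) : ∃ b : Fin d → ℤ, b +ᵥ (w : V) = e w := by
    have : (Equiv.ofBijective _ (hW'.bijective_mk hΓ)) (e w) =
        (Equiv.ofBijective _ (hW.bijective_mk hΓ)) w := by simp [e]
    exact Quotient.exact this
  choose b hb using he
  set D : Matrix W W (AddMonoidAlgebra R (Fin d → ℤ)) :=
    Matrix.diagonal fun w => AddMonoidAlgebra.single (b w) 1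
  set D' : Matrix W W (AddMonoidAlgebra R (Fin d → ℤ)) :=
    Matrix.diagonal fun w => AddMonoidAlgebra.single (-b w) 1
  have hDD : D' * D = 1 := by
    simp [D, D', Matrix.diagonal_mul_diagonal, AddMonoidAlgebra.single_mul_single,
      ← AddMonoidAlgebra.one_def]
  have hconj : (hΓ.floquet y W').submatrix e e = D * (hΓ.floquet y W * D') := by
    ext u v a
    rw [Matrix.diagonal_mul, Matrix.mul_diagonal, AddMonoidAlgebra.coeff_single_mul_apply,
      AddMonoidAlgebra.coeff_mul_single_apply, Matrix.submatrix_apply, coeff_floquet,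
      coeff_floquet, ← hb, ← hb, hΓ.floquetCoeff_vadd y]
    · simp
    · intro h; rw [Subtype.ext h]
    · exact hW.eq_of_vadd_eq hΓ u.2 v.2
  rw [← Matrix.charpoly_reindex e.symm, Matrix.reindex_apply, Equiv.symm_symm, hconj,
    Matrix.charpoly_mul_comm, Matrix.mul_assoc, hDD, Matrix.mul_one]

/-! ### Components of support zero -/

open Classical in
/-- A component of support zero gives a diagonal block of the Floquet matrix with constant entries,
whose eigenvalues are constant. -/
theorem IsPeriodic.exists_isRoot_of_isComponent (hΓ : IsPeriodic d Γ)
    (y : VertexOrbit d V ⊕ EdgeOrbit d Γ → ℂ) {W U : Finset V} (hU : U.Nonempty)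
    (hWU : IsComponent d Γ W U) (h0 : HasSupportZero d Γ U) :
    ∃ c : ℂ, (hΓ.floquet y W).charpoly.IsRoot (algebraMap ℂ _ c) := by
  have hsupp : ∀ u ∈ U, ∀ v ∈ U, ∀ a : Fin d → ℤ, Γ.Adj u (a +ᵥ v) → a = 0 := by
    intro u hu v hv a ha
    have : a ∈ support d Γ U := ⟨u, hu, v, hv, ha⟩
    rcases h0 with h | h <;> rw [h] at this
    · exact this.elim
    · exact this
  set B : Matrix {w : W // w.1 ∈ U} {w : W // w.1 ∈ U} ℂ :=
    Matrix.of fun u v => floquetCoeff y u.1.1 v.1.1 0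
  have hne : Nonempty {w : W // w.1 ∈ U} := by
    obtain ⟨u, hu⟩ := hU
    exact ⟨⟨⟨u, hWU.1 hu⟩, hu⟩⟩
  obtain ⟨c, hc⟩ := IsAlgClosed.exists_root B.charpoly (by
    rw [Matrix.charpoly_degree_eq_dim]
    exact_mod_cast Fintype.card_ne_zero)
  refine ⟨c, ?_⟩
  rw [Polynomial.IsRoot, Matrix.eval_charpoly] at hc ⊢
  rw [Matrix.twoBlockTriangular_det _ (fun w : W => w.1 ∈ U)]
  · have : Matrix.toSquareBlockProp (Matrix.scalar W (algebraMap ℂ (Laurent d) c) -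
        hΓ.floquet y W) (fun w : W => w.1 ∈ U) =
        (algebraMap ℂ (Laurent d)).mapMatrix (Matrix.scalar _ c - B) := by
      have hB (u v : {w : W // w.1 ∈ U}) :
          hΓ.floquet y W u.1 v.1 = algebraMap ℂ (Laurent d) (B u v) := by
        ext a
        by_cases ha : a = 0
        · subst ha; simp [coeff_floquet, B]
        · rw [coeff_floquet, floquetCoeff_eq_zero _ (fun h => ha h.2)
            (fun h => ha (hsupp _ u.2 _ v.2 _ h))]
          simp [Ne.symm ha]
      ext1 u v
      rw [RingHom.mapMatrix_apply, Matrix.map_apply, Matrix.toSquareBlockProp_def,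
        Matrix.of_apply, Matrix.sub_apply, Matrix.sub_apply, hB, map_sub]
      congr 1
      by_cases huv : u = v
      · subst huv; simp
      · have : u.1 ≠ v.1 := fun h => huv (Subtype.ext h)
        simp [huv, this]
    rw [this, ← RingHom.map_det, hc, map_zero, zero_mul]
  · intro u hu v hv
    have huv : u ≠ v := fun h => hu (h ▸ hv)
    have : hΓ.floquet y W u v = 0 := by
      ext a
      rw [coeff_floquet]
      refine floquetCoeff_eq_zero _ (fun h => huv (Subtype.ext h.1)) fun h => ?_
      refine hWU.2 v hv u u.2 hu (-a) ?_
      simpa using hΓ.adj_vadd (-a) _ _ h.symm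
    simp [huv, this]

section Reachable

theorem IsPeriodic.reachable_vadd (hΓ : IsPeriodic d Γ) (a : Fin d → ℤ) {u v : V}
    (h : Γ.Reachable u v) : Γ.Reachable (a +ᵥ u) (a +ᵥ v) :=
  h.map (⟨fun v => a +ᵥ v, fun h => hΓ.adj_vadd a _ _ h⟩ : Γ →g Γ)

open Classical in
/-- If the connected component of `u₀` in `Γ` contains no other vertex of the orbit of `u₀`, then it
contains at most one vertex of each orbit. It is then a component of support zero of the fundamental
domain obtained from `W₀` by moving into it every vertex that has a translate there. -/
theorem IsPeriodic.exists_isComponent_of_reachable (hΓ : IsPeriodic d Γ) {W₀ : Finset V}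
    (hW₀ : IsFundamentalDomain d W₀) (u₀ : V)
    (hu₀ : ∀ a : Fin d → ℤ, Γ.Reachable u₀ (a +ᵥ u₀) → a = 0) :
    ∃ W : Finset V, IsFundamentalDomain d W ∧ ∃ U : Finset V, U.Nonempty ∧
      IsComponent d Γ W U ∧ HasSupportZero d Γ U := by
  have hC {x : V} {b : Fin d → ℤ} (hx : Γ.Reachable u₀ x) (hbx : Γ.Reachable u₀ (b +ᵥ x)) :
      b = 0 := hu₀ b (hbx.trans (hΓ.reachable_vadd b hx).symm)
  have hf (w : V) : ∃ b : Fin d → ℤ,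
      (∃ a : Fin d → ℤ, Γ.Reachable u₀ (a +ᵥ w)) → Γ.Reachable u₀ (b +ᵥ w) := by
    by_cases h : ∃ a : Fin d → ℤ, Γ.Reachable u₀ (a +ᵥ w)
    · exact ⟨h.choose, fun _ => h.choose_spec⟩
    · exact ⟨0, fun h' => (h h').elim⟩
  choose b hb using hf
  set W := W₀.image fun w => b w +ᵥ w
  have hW : IsFundamentalDomain d W := by
    refine ⟨fun v => ?_, ?_⟩
    · obtain ⟨w, hw, a, rfl⟩ := hW₀.1 v
      exact ⟨_, Finset.mem_image_of_mem _ hw, a + -b w, by rw [add_vadd, neg_vadd_vadd]⟩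
    · rw [Finset.card_image_of_injOn, hW₀.2]
      intro u hu v hv h
      exact hW₀.eq_of_vadd_eq hΓ hu hv h
  refine ⟨W, hW, W.filter (Γ.Reachable u₀), ?_, ⟨Finset.filter_subset _ _, ?_⟩, ?_⟩
  · obtain ⟨w, hw, a, h⟩ := hW₀.1 u₀
    refine ⟨b w +ᵥ w, Finset.mem_filter.2 ⟨Finset.mem_image_of_mem _ hw, hb w ⟨a, ?_⟩⟩⟩
    rw [← h]
  · intro u hu v hv hvU a hadj
    obtain ⟨w, hw, rfl⟩ := Finset.mem_image.1 hv
    refine hvU (Finset.mem_filter.2 ⟨hv, hb w ⟨a + b w, ?_⟩⟩)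
    rw [add_vadd]
    exact (Finset.mem_filter.1 hu).2.trans hadj.reachable
  · refine Set.subset_singleton_iff_eq.1 ?_
    rintro a ⟨u, hu, v, hv, hadj⟩
    exact hC (Finset.mem_filter.1 hv).2 ((Finset.mem_filter.1 hu).2.trans hadj.reachable)

/-! ### Powers of the Floquet matrix and closed walks -/

theorem coeff_mul_ne_zero {G : Type*} [AddCommMonoid G] {f g : AddMonoidAlgebra ℕ G} {a b : G}
    (hf : f.coeff a ≠ 0) (hg : g.coeff b ≠ 0) : (f * g).coeff (a + b) ≠ 0 := by
  classical
  rw [AddMonoidAlgebra.coeff_mul]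
  intro h
  have h1 := Finset.sum_eq_zero_iff.1 h a (Finsupp.mem_support_iff.2 hf)
  have h2 := Finset.sum_eq_zero_iff.1 h1 b (Finsupp.mem_support_iff.2 hg)
  simp [hf, hg] at h2

open Classical in
/-- A walk from `u` to `b +ᵥ w` contributes to the coefficient of `z^b` in the `(u, w)` entry of a
power of the Floquet matrix, and with natural labels the contributions do not cancel. -/
theorem IsPeriodic.exists_coeff_floquet_pow_ne_zero (hΓ : IsPeriodic d Γ) {W : Finset V}
    (hW : IsFundamentalDomain d W) (y : VertexOrbit d V ⊕ EdgeOrbit d Γ → ℕ)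
    (hy : ∀ q, y (Sum.inr q) ≠ 0) (u : W) {x : V} (hx : Γ.Reachable u x) (w : W)
    (b : Fin d → ℤ) (hxw : x = b +ᵥ (w : V)) : ∃ k, ((hΓ.floquet y W ^ k) u w).coeff b ≠ 0 := by
  rw [SimpleGraph.reachable_iff_reflTransGen] at hx
  induction hx generalizing w b with
  | refl =>
    obtain rfl : u = w := Subtype.ext
      (hW.eq_of_vadd_eq (a := 0) (b := b) hΓ u.2 w.2 (by rw [zero_vadd]; exact hxw))
    obtain rfl : b = 0 := hΓ.free b _ hxw.symm
    exact ⟨0, by simp⟩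
  | @tail x x' _ hadj ih =>
    obtain ⟨v, hv, c, rfl⟩ := hW.1 x
    obtain ⟨k, hk⟩ := ih ⟨v, hv⟩ c rfl
    subst hxw
    have hadj' : Γ.Adj v ((-c + b) +ᵥ (w : V)) := by
      have := hΓ.adj_vadd (-c) _ _ hadj
      rwa [neg_vadd_vadd, ← add_vadd] at this
    have h2 : (hΓ.floquet y W ⟨v, hv⟩ w).coeff (-c + b) ≠ 0 := by
      rw [coeff_floquet, floquetCoeff, dif_pos hadj']
      exact fun h => hy _ (Nat.add_eq_zero_iff.1 h).2
    have h3 := coeff_mul_ne_zero hk h2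
    refine ⟨k + 1, ?_⟩
    rw [pow_succ, Matrix.mul_apply, AddMonoidAlgebra.coeff_sum, Finsupp.finsetSum_apply]
    intro h
    have := Finset.sum_eq_zero_iff.1 h ⟨v, hv⟩ (Finset.mem_univ _)
    rw [add_neg_cancel_left] at h3
    exact h3 this

open Classical in
/-- If every labeling has a flat band, then some vertex is connected to none of its nontrivial
translates. Only labelings with all edge labels `1` and with potentials in `ℕ` are needed. -/
theorem IsPeriodic.exists_reachable_of_forall_isRoot (hΓ : IsPeriodic d Γ) {W : Finset V}
    (hW : IsFundamentalDomain d W)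
    (hflat : ∀ y : VertexOrbit d V ⊕ EdgeOrbit d Γ → ℂ,
      ∃ c : ℂ, (hΓ.floquet y W).charpoly.IsRoot (algebraMap ℂ _ c)) :
    ∃ u₀ : V, ∀ a : Fin d → ℤ, Γ.Reachable u₀ (a +ᵥ u₀) → a = 0 := by
  set e : W ≃ VertexOrbit d V := Equiv.ofBijective _ (hW.bijective_mk hΓ)
  set y : (W → ℕ) → VertexOrbit d V ⊕ EdgeOrbit d Γ → ℕ := fun p => Sum.elim (p ∘ e.symm) 1
  set yc : (W → ℕ) → VertexOrbit d V ⊕ EdgeOrbit d Γ → ℂ := fun p => Nat.castRingHom ℂ ∘ y p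
  have hdiag (p : W → ℕ) : hΓ.floquet (yc 0) W + Matrix.diagonal (fun w => (p w : Laurent d)) =
      hΓ.floquet (yc p) W := by
    have he (w : W) : e.symm (Quotient.mk _ w.1) = w := e.symm_apply_apply w
    ext u v a
    rw [Matrix.add_apply, AddMonoidAlgebra.coeff_add, Finsupp.add_apply, coeff_floquet,
      coeff_floquet]
    unfold floquetCoeff
    have hE (q) : yc 0 (Sum.inr q) = yc p (Sum.inr q) := rfl
    simp only [hE]
    rw [add_right_comm]
    congr 1
    by_cases huv : u = v
    · subst huv
      have hc : ((p u : ℕ) : Laurent d) = AddMonoidAlgebra.single 0 (p u : ℂ) := by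
        rw [← map_natCast (algebraMap ℂ (Laurent d))]; rfl
      by_cases ha : a = 0
      · subst ha; simp [yc, y, he, hc]
      · simp [ha, hc]
    · have : u.1 ≠ v.1 := fun h => huv (Subtype.ext h)
      simp [huv, this]
  obtain ⟨p, u, hpu⟩ := Matrix.exists_pow_apply_eq_algebraMap
    (augmentation ℂ (Fin d → ℤ)) (hΓ.floquet (yc 0) W) (fun p => by
      obtain ⟨c, hc⟩ := hflat (yc p)
      refine ⟨c, ?_⟩
      rwa [Polynomial.IsRoot, Matrix.eval_charpoly, ← hdiag] at hc)
  refine ⟨u, fun a ha => ?_⟩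
  obtain ⟨k, hk⟩ := hΓ.exists_coeff_floquet_pow_ne_zero hW (y p) (by simp [y]) u ha u a rfl
  obtain ⟨c, hc⟩ := hpu k
  by_contra ha0
  rw [hdiag, ← hΓ.floquet_map, ← RingHom.mapMatrix_apply, ← map_pow, RingHom.mapMatrix_apply,
    Matrix.map_apply] at hc
  have := congrArg (fun f => f.coeff a) hc
  simp only [AddMonoidAlgebra.coeff_mapRingHom] at this
  refine hk ?_
  simpa [Finsupp.single_apply, Ne.symm ha0] using this

end Reachable

end PeriodicGraph

open PeriodicGraph in
theorem mainTheorem1 (d : ℕ) {V : Type*} [AddAction (Fin d → ℤ) V] (Γ : SimpleGraph V)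
    (hΓ : PeriodicGraph.IsPeriodic d Γ) :
    PeriodicGraph.IsGeneric d Γ (fun ℓ =>
      ∀ W₀ : Finset V, PeriodicGraph.IsFundamentalDomain d W₀ →
        (PeriodicGraph.HasLinearFactor (ℓ.dispersion W₀) ↔
          ∃ W : Finset V, PeriodicGraph.IsFundamentalDomain d W ∧
            ∃ U : Finset V, U.Nonempty ∧ PeriodicGraph.IsComponent d Γ W U ∧
              PeriodicGraph.HasSupportZero d Γ U)) := by
  classical
  have hne : Nonempty (Labeling d Γ) := ⟨(Labeling.coord d Γ).symm 0⟩
  by_cases hcomp : ∃ W : Finset V, IsFundamentalDomain d W ∧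
      ∃ U : Finset V, U.Nonempty ∧ IsComponent d Γ W U ∧ HasSupportZero d Γ U
  · refine ⟨∅, ⟨{1}, by simp⟩, Set.empty_ne_univ, fun ℓ _ W₀ hW₀ => iff_of_true ?_ hcomp⟩
    obtain ⟨W, hW, U, hU, hWU, h0⟩ := hcomp
    rw [hΓ.hasLinearFactor_dispersion_iff, hΓ.charpoly_floquet_eq _ hW hW₀]
    exact hΓ.exists_isRoot_of_isComponent _ hU hWU h0
  by_cases hdom : ∃ W₁ : Finset V, IsFundamentalDomain d W₁
  -- The polynomial `P` below is built from one fundamental domain `W₁`; it serves for all of them,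
  -- since the characteristic polynomial does not depend on the domain.
  · obtain ⟨W₁, hW₁⟩ := hdom
    obtain ⟨y₀, hy₀⟩ : ∃ y₀ : VertexOrbit d V ⊕ EdgeOrbit d Γ → ℂ, ∀ c : ℂ,
        ¬ (hΓ.floquet y₀ W₁).charpoly.IsRoot (algebraMap ℂ _ c) := by
      by_contra! h
      obtain ⟨u₀, hu₀⟩ := hΓ.exists_reachable_of_forall_isRoot hW₁ h
      exact hcomp (hΓ.exists_isComponent_of_reachable hW₁ u₀ hu₀)
    have hmap (y : VertexOrbit d V ⊕ EdgeOrbit d Γ → ℂ) :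
        (hΓ.floquet MvPolynomial.X W₁).map (AddMonoidAlgebra.mapRingHom _
          (MvPolynomial.aeval (R := ℂ) y).toRingHom) = hΓ.floquet y W₁ := by
      rw [hΓ.floquet_map]
      congr 1
      ext q
      simp
    obtain ⟨P, hP₀, hP⟩ := AddMonoidAlgebra.exists_eval_ne_zero_of_charpoly_not_isRoot
      (hΓ.floquet (R := MvPolynomial (VertexOrbit d V ⊕ EdgeOrbit d Γ) ℂ) MvPolynomial.X W₁)
      (MvPolynomial.aeval y₀) (by rwa [hmap])
    refine ⟨{ℓ | ∀ p ∈ ({P} : Set _), MvPolynomial.eval (Labeling.coord d Γ ℓ) p = 0},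
      ⟨{P}, rfl⟩, fun huniv => ?_, fun ℓ hℓ W₀ hW₀ => iff_of_false (fun hlin => hℓ ?_) hcomp⟩
    · have := (huniv ▸ Set.mem_univ ((Labeling.coord d Γ).symm y₀) :
        (Labeling.coord d Γ).symm y₀ ∈ {ℓ | ∀ p ∈ ({P} : Set _),
          MvPolynomial.eval (Labeling.coord d Γ ℓ) p = 0}) P rfl
      rw [Equiv.apply_symm_apply] at this
      exact hP₀ (by rwa [MvPolynomial.aeval_eq_eval])
    · rintro _ rfl
      rw [hΓ.hasLinearFactor_dispersion_iff, hΓ.charpoly_floquet_eq _ hW₁ hW₀] at hlin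
      have := hP (MvPolynomial.aeval (Labeling.coord d Γ ℓ)) (by rwa [hmap])
      rwa [MvPolynomial.aeval_eq_eval] at this
  · exact ⟨∅, ⟨{1}, by simp⟩, Set.empty_ne_univ, fun ℓ _ W₀ hW₀ => (hdom ⟨W₀, hW₀⟩).elim⟩
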